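/- Let $p_{X_1}$ and $p_{X_2}$ be probability distributions on $[0,\infty)$ with mean one. For $i=1,2$ let $L_i$ be the Lorenz curve of $p_{X_i}$: for $u\in[0,1]$, $$L_i(u)=\min_{p_{U|X_i},\,\mathcal A\,:\,\mathbf P(U\in\mathcal A)=u}\mathbf E\big[X_i\,\mathbf 1_{U\in\mathcal A}\big],$$ where $X_i\sim p_{X_i}$ and the minimum is over all conditional distributions $p_{U|X_i}$ of a real random variable $U$ given $X_i$ and all measurable sets $\mathcal A\subseteq\mathbb R$ with $\mathbf P(U\in\mathcal A)=u$. Then there exists a joint distribution $p_{X_1,X_2}$ with marginals $p_{X_1}$ and $p_{X_2}$ such that $\mathbf E(X_2\mid X_1)=X_1$ almost surely if and only if $L_1(u)\ge L_2(u)$ for all $u\in[0,1]$. -/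

import Mathlib

open MeasureTheory ProbabilityTheory

/-- The values `E [X 1_{U ∈ A}]`, where `X` has law `μ`, over all conditional laws `κ` of a real
random variable `U` given `X` and all measurable sets `A` with `P(U ∈ A) = u`.
The joint law of `(X, U)` is `μ ⊗ₘ κ`. -/
def lorenzValues (μ : Measure ℝ) (u : ℝ) : Set ℝ :=
  {v | ∃ (κ : Kernel ℝ ℝ) (A : Set ℝ), IsMarkovKernel κ ∧ MeasurableSet A ∧
    (μ ⊗ₘ κ).real (Prod.snd ⁻¹' A) = u ∧
    v = ∫ z in Prod.snd ⁻¹' A, z.1 ∂(μ ⊗ₘ κ)}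

/-- The Lorenz curve of the law `μ` of a non-negative random variable `X`: the minimum of
`E [X 1_{U ∈ A}]` over all `U` correlated with `X` and all events `U ∈ A` of probability `u`. -/
noncomputable def lorenz (μ : Measure ℝ) (u : ℝ) : ℝ :=
  sInf (lorenzValues μ u)

/-- For `u ∈ [0,1]` the minimization defining the Lorenz curve is over a non-empty set. -/
theorem lorenzValues_nonempty (μ : Measure ℝ) [IsProbabilityMeasure μ] {u : ℝ}
    (hu : u ∈ Set.Icc (0 : ℝ) 1) : (lorenzValues μ u).Nonempty := by
  have : IsProbabilityMeasure (volume.restrict (Set.Icc (0 : ℝ) 1)) := ⟨by simp⟩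
  refine ⟨_, Kernel.const ℝ (volume.restrict (Set.Icc (0 : ℝ) 1)), Set.Icc 0 u, inferInstance,
    measurableSet_Icc, ?_, rfl⟩
  have h : Prod.snd ⁻¹' Set.Icc 0 u = (Set.univ : Set ℝ) ×ˢ Set.Icc (0 : ℝ) u := by
    ext; simp
  rw [h, Measure.compProd_const, measureReal_def, Measure.prod_prod,
    Measure.restrict_apply measurableSet_Icc,
    Set.inter_eq_left.2 (Set.Icc_subset_Icc_right hu.2)]
  simp [hu.1]

/-- For a non-negative law the minimization defining the Lorenz curve is bounded below. -/
theorem lorenzValues_bddBelow (μ : Measure ℝ) [IsProbabilityMeasure μ]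
    (hμ : ∀ᵐ x ∂μ, 0 ≤ x) (u : ℝ) : BddBelow (lorenzValues μ u) := by
  refine ⟨0, ?_⟩
  rintro v ⟨κ, A, hκ, hA, -, rfl⟩
  refine integral_nonneg_of_ae (ae_restrict_of_ae ?_)
  have h : ∀ᵐ x ∂((μ ⊗ₘ κ).map Prod.fst), 0 ≤ x := by
    have := Measure.fst_compProd μ κ
    rw [Measure.fst] at this
    rwa [this]
  exact ae_of_ae_map measurable_fst.aemeasurable h

/-- `π` is a joint law of `(X₁, X₂)` with marginals `μ₁`, `μ₂` and `E (X₂ | X₁) = X₁` almost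
surely; conditioning on `X₁` is conditioning on the σ-algebra generated by the first coordinate. -/
structure IsFairCoupling (μ₁ μ₂ : Measure ℝ) (π : Measure (ℝ × ℝ)) : Prop where
  fst_eq : π.fst = μ₁
  snd_eq : π.snd = μ₂
  condExp_eq :
    π[(Prod.snd : ℝ × ℝ → ℝ) | MeasurableSpace.comap (Prod.fst : ℝ × ℝ → ℝ) inferInstance] =ᵐ[π] Prod.fst

open Set Filter Topology

/-! If a fair coupling exists, let `U` be drawn from `X₁` alone, without further regard to `X₂`.
Pulling the factor P(U ∈ A | X₁) out of the conditional expectation gives E[X₂ 1_{U ∈ A}] = E[X₁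
1_{U ∈ A}], so every value competing in the first minimum also competes in the second
(`lorenzValues_subset_of_isFairCoupling`).

Conversely, let f₁, f₂ be the quantile functions on (0,1). The Lorenz curve is the partial integral
of the quantile function, so g = f₁ - f₂ has nonnegative partial integrals and total integral zero.
Hence g⁺ has the same mass as g⁻ and lies stochastically to its left, and an ordered coupling Q
transports one to the other. For a transported pair a ≤ b, f₂(a) < f₁(a) ≤ f₁(b) < f₂(b). Exchanging
the f₂-values of a and b on mass dQ / (f₂(b) - f₂(a)) raises the integral of `X₂` at a and lowers it
at b by exactly dQ. The marginals are kept and the defect g of the comonotone pair (f₁, f₂) is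
cancelled (`exists_fair_rearrangement`). -/

/-! ### Quantile functions -/

/-- The uniform law on the open unit interval. -/
noncomputable abbrev unitUniform : Measure ℝ := volume.restrict (Ioo (0 : ℝ) 1)

instance isProbabilityMeasure_unitUniform : IsProbabilityMeasure unitUniform := ⟨by simp⟩

theorem unitUniform_real_Iic {t : ℝ} (h0 : 0 ≤ t) (h1 : t ≤ 1) :
    unitUniform.real (Iic t) = t := by
  -- The half-open interval makes the intersection below equal to `Ioc 0 t` even at t = 1.
  rw [measureReal_def, unitUniform, Measure.restrict_congr_set Ioo_ae_eq_Ioc,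
    Measure.restrict_apply measurableSet_Iic]
  have : Iic t ∩ Ioc 0 1 = Ioc 0 t := by
    ext x; simp only [mem_inter_iff, mem_Iic, mem_Ioc]; grind
  simp [this, h0]

/-- The quantile function of a law on the line, set to zero outside the open unit interval. -/
noncomputable def quantile (μ : Measure ℝ) (w : ℝ) : ℝ :=
  open Classical in if w ∈ Ioo (0 : ℝ) 1 then sInf {x | w ≤ cdf μ x} else 0

/-- Right continuity of the cdf makes the infimum attained; the limits at ±∞ make the set nonempty
and bounded below for w in (0,1). -/
theorem quantile_le_iff (μ : Measure ℝ) {w : ℝ} (hw : w ∈ Ioo (0 : ℝ) 1) (x : ℝ) :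
    quantile μ w ≤ x ↔ w ≤ cdf μ x := by
  rw [quantile, if_pos hw]
  have hne : {x | w ≤ cdf μ x}.Nonempty :=
    ((tendsto_cdf_atTop μ).eventually (eventually_ge_nhds hw.2)).exists
  have hbdd : BddBelow {x | w ≤ cdf μ x} := by
    obtain ⟨b, hb⟩ := ((tendsto_cdf_atBot μ).eventually (eventually_lt_nhds hw.1)).exists
    refine ⟨b, fun y hy => ?_⟩
    by_contra! h
    exact absurd (hy.trans (monotone_cdf μ h.le)) (not_le.2 hb)
  refine ⟨fun h => ?_, fun h => csInf_le hbdd h⟩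
  have hright : Tendsto (cdf μ) (𝓝[>] x) (𝓝 (cdf μ x)) :=
    ((cdf μ).right_continuous x).tendsto.mono_left (nhdsWithin_mono _ Ioi_subset_Ici_self)
  refine ge_of_tendsto hright ?_
  filter_upwards [self_mem_nhdsWithin] with y hy
  obtain ⟨z, hz, hzy⟩ := exists_lt_of_csInf_lt hne (h.trans_lt hy)
  exact le_trans hz (monotone_cdf μ hzy.le)

theorem measurable_quantile (μ : Measure ℝ) : Measurable (quantile μ) := by
  refine measurable_of_Iic fun x => ?_
  have : quantile μ ⁻¹' Iic x =
      (Ioo 0 1 ∩ Iic (cdf μ x)) ∪ ((Ioo (0 : ℝ) 1)ᶜ ∩ {_w | 0 ≤ x}) := by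
    ext w
    by_cases hw : w ∈ Ioo (0 : ℝ) 1
    · simp only [mem_preimage, mem_Iic, quantile_le_iff μ hw, mem_union, mem_inter_iff, hw,
        mem_compl_iff, true_and, not_true_eq_false, false_and, or_false]
    · simp only [mem_preimage, mem_Iic, mem_union, mem_inter_iff, hw, quantile, if_neg,
        mem_compl_iff, false_and, not_false_eq_true, true_and, false_or, mem_ofPred_eq]
  rw [this]
  exact (measurableSet_Ioo.inter measurableSet_Iic).union
    (measurableSet_Ioo.compl.inter (MeasurableSet.const _))

theorem monotoneOn_quantile (μ : Measure ℝ) : MonotoneOn (quantile μ) (Ioo 0 1) :=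
  fun _ hv _ hw hvw => (quantile_le_iff μ hv _).2 (hvw.trans ((quantile_le_iff μ hw _).1 le_rfl))

theorem quantile_le_quantile {μ ν : Measure ℝ} (h : ∀ x, cdf ν x ≤ cdf μ x) {w : ℝ}
    (hw : w ∈ Ioo (0 : ℝ) 1) : quantile μ w ≤ quantile ν w :=
  (quantile_le_iff μ hw _).2 (((quantile_le_iff ν hw _).1 le_rfl).trans (h _))

theorem map_quantile (μ : Measure ℝ) [IsProbabilityMeasure μ] :
    unitUniform.map (quantile μ) = μ := by
  have := Measure.isProbabilityMeasure_map (μ := unitUniform) (measurable_quantile μ).aemeasurable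
  refine Measure.eq_of_cdf _ _ (StieltjesFunction.ext fun x => ?_)
  rw [cdf_eq_real, map_measureReal_apply (measurable_quantile μ) measurableSet_Iic,
    ← unitUniform_real_Iic (cdf_nonneg μ x) (cdf_le_one μ x)]
  refine measureReal_congr ?_
  filter_upwards [ae_restrict_mem measurableSet_Ioo] with w hw
  exact propext (quantile_le_iff μ hw x)

/-! ### Ordered couplings -/

/-- Two probability laws on the line, the first stochastically smaller than the second, have an
ordered coupling. -/
theorem exists_ordered_coupling_of_isProbabilityMeasure (μ ν : Measure ℝ) [IsProbabilityMeasure μ]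
    [IsProbabilityMeasure ν] (h : ∀ x, ν (Iic x) ≤ μ (Iic x)) :
    ∃ Q : Measure (ℝ × ℝ), Q.fst = μ ∧ Q.snd = ν ∧ ∀ᵐ z ∂Q, z.1 ≤ z.2 := by
  have hm := (measurable_quantile μ).prodMk (measurable_quantile ν)
  -- One uniform variable drives both quantile functions.
  refine ⟨unitUniform.map fun w => (quantile μ w, quantile ν w), ?_, ?_, ?_⟩
  · rw [Measure.fst_map_prodMk (measurable_quantile ν), map_quantile]
  · rw [Measure.snd_map_prodMk (measurable_quantile μ), map_quantile]
  · rw [ae_map_iff hm.aemeasurable (measurableSet_le measurable_fst measurable_snd)]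
    filter_upwards [ae_restrict_mem measurableSet_Ioo] with w hw
    refine quantile_le_quantile (fun x => ?_) hw
    rw [cdf_eq_real, cdf_eq_real]
    exact ENNReal.toReal_mono (measure_ne_top _ _) (h x)

/-- Two finite measures on the line of the same mass, the first stochastically smaller than the
second, have an ordered coupling. -/
theorem exists_ordered_coupling (μ ν : Measure ℝ) [IsFiniteMeasure μ] [IsFiniteMeasure ν]
    (huniv : μ univ = ν univ) (h : ∀ x, ν (Iic x) ≤ μ (Iic x)) :
    ∃ Q : Measure (ℝ × ℝ), Q.fst = μ ∧ Q.snd = ν ∧ ∀ᵐ z ∂Q, z.1 ≤ z.2 := by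
  by_cases h0 : μ = 0
  · have hν : ν = 0 := by rw [← Measure.measure_univ_eq_zero, ← huniv, h0]; simp
    exact ⟨0, by simp [h0], by simp [hν], by simp⟩
  have h1 : μ univ ≠ 0 := by simpa using h0
  have htop : μ univ ≠ ⊤ := measure_ne_top _ _
  have hp : IsProbabilityMeasure ((μ univ)⁻¹ • μ) :=
    ⟨by simp [ENNReal.inv_mul_cancel h1 htop]⟩
  have hq : IsProbabilityMeasure ((μ univ)⁻¹ • ν) :=
    ⟨by simp [← huniv, ENNReal.inv_mul_cancel h1 htop]⟩
  obtain ⟨Q, hQ1, hQ2, hQ⟩ := exists_ordered_coupling_of_isProbabilityMeasure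
    ((μ univ)⁻¹ • μ) ((μ univ)⁻¹ • ν)
    (fun x => by simpa using mul_le_mul_right (h x) _)
  refine ⟨μ univ • Q, ?_, ?_, Measure.ae_smul_measure hQ _⟩
  · rw [Measure.fst, Measure.map_smul, ← Measure.fst, hQ1, smul_smul,
      ENNReal.mul_inv_cancel h1 htop, one_smul]
  · rw [Measure.snd, Measure.map_smul, ← Measure.snd, hQ2, smul_smul,
      ENNReal.mul_inv_cancel h1 htop, one_smul]

/-! ### Dividing by densities -/

/-- The product g⁺ · (1/g)⁺ is the indicator of {0 < g}. -/
theorem lintegral_withDensity_inv_le {α : Type*} [MeasurableSpace α] {ν : Measure α} {g : α → ℝ}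
    (hg : Measurable g) {B : Set α} (hB : MeasurableSet B) :
    ∫⁻ a in B, ENNReal.ofReal (g a)⁻¹ ∂(ν.withDensity fun a => ENNReal.ofReal (g a))
      ≤ ν ({a | 0 < g a} ∩ B) := by
  have hpos : MeasurableSet {a | 0 < g a} := measurableSet_lt measurable_const hg
  have hinv : Measurable fun a => (g a)⁻¹ := hg.inv
  rw [restrict_withDensity hB, lintegral_withDensity_eq_lintegral_mul _ hg.ennreal_ofReal
    hinv.ennreal_ofReal, ← Measure.restrict_apply hpos, ← lintegral_indicator_one hpos]
  refine lintegral_mono fun a => ?_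
  by_cases ha : 0 < g a
  · simp only [Pi.mul_apply, indicator_of_mem (show a ∈ {a | 0 < g a} from ha), Pi.one_apply]
    rw [← ENNReal.ofReal_mul ha.le, mul_inv_cancel₀ ha.ne', ENNReal.ofReal_one]
  · simp [ENNReal.ofReal_of_nonpos (not_lt.1 ha)]

theorem ae_pos_withDensity_ofReal {α : Type*} [MeasurableSpace α] (ν : Measure α) {g : α → ℝ}
    (hg : Measurable g) : ∀ᵐ a ∂(ν.withDensity fun a => ENNReal.ofReal (g a)), 0 < g a := by
  rw [ae_withDensity_iff hg.ennreal_ofReal]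
  exact .of_forall fun a ha => by simpa using ha

/-- If a measure `Q` has image `g⁺ ν`, then dividing it by a density `D ≥ g` yields an image at most
`ν` on `{0 < g}`. -/
theorem map_withDensity_inv_le {α β : Type*} [MeasurableSpace α] [MeasurableSpace β]
    {ν : Measure α} {g : α → ℝ} (hg : Measurable g) {Q : Measure β} {p : β → α}
    (hp : Measurable p) (hQ : Q.map p = ν.withDensity fun a => ENNReal.ofReal (g a)) {D : β → ℝ}
    (hD : ∀ᵐ z ∂Q, g (p z) ≤ D z) :
    (Q.withDensity fun z => ENNReal.ofReal (D z)⁻¹).map p ≤ ν.restrict {a | 0 < g a} := by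
  have hinv : Measurable fun a => (g a)⁻¹ := hg.inv
  have hpos : ∀ᵐ z ∂Q, 0 < g (p z) :=
    ae_of_ae_map hp.aemeasurable (hQ ▸ ae_pos_withDensity_ofReal ν hg)
  refine Measure.le_iff.2 fun B hB => ?_
  rw [Measure.map_apply hp hB, withDensity_apply _ (hp hB), Measure.restrict_apply hB, inter_comm]
  refine le_trans ?_ (lintegral_withDensity_inv_le hg hB)
  rw [← hQ, setLIntegral_map hB hinv.ennreal_ofReal hp]
  refine lintegral_mono_ae (ae_restrict_of_ae ?_)
  filter_upwards [hD, hpos] with z hz hz'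
  exact ENNReal.ofReal_le_ofReal (inv_anti₀ hz' hz)

/-- Dividing a measure by a positive density and multiplying the integrand by it leaves the integral
unchanged. -/
theorem integral_withDensity_inv_mul {β : Type*} [MeasurableSpace β] {Q : Measure β} {D : β → ℝ}
    (hDm : Measurable D) (hD : ∀ᵐ z ∂Q, 0 < D z) (f : β → ℝ) :
    ∫ z, f z * D z ∂(Q.withDensity fun z => ENNReal.ofReal (D z)⁻¹) = ∫ z, f z ∂Q := by
  have hinv : Measurable fun z => (D z)⁻¹ := hDm.inv
  rw [integral_withDensity_eq_integral_toReal_smul hinv.ennreal_ofReal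
    (.of_forall fun _ => ENNReal.ofReal_lt_top)]
  refine integral_congr_ae ?_
  filter_upwards [hD] with z hz
  rw [ENNReal.toReal_ofReal (inv_nonneg.2 hz.le), smul_eq_mul]
  field_simp

theorem integral_withDensity_ofReal_sub {α : Type*} [MeasurableSpace α] {ν : Measure α}
    {g φ : α → ℝ} (hg : Measurable g) (hgi : Integrable g ν) (hφ : Measurable φ)
    (hφb : ∀ a, ‖φ a‖ ≤ 1) :
    ∫ a, φ a ∂(ν.withDensity fun a => ENNReal.ofReal (g a))
      - ∫ a, φ a ∂(ν.withDensity fun a => ENNReal.ofReal (-g a)) = ∫ a, φ a * g a ∂ν := by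
  have hneg : Measurable fun a => -g a := hg.neg
  rw [integral_withDensity_eq_integral_toReal_smul hg.ennreal_ofReal
      (.of_forall fun _ => ENNReal.ofReal_lt_top),
    integral_withDensity_eq_integral_toReal_smul hneg.ennreal_ofReal
      (.of_forall fun _ => ENNReal.ofReal_lt_top), ← integral_sub]
  · refine integral_congr_ae (.of_forall fun a => ?_)
    simp only [ENNReal.toReal_ofReal', smul_eq_mul]
    rw [← sub_mul, mul_comm]
    congr 1
    rcases le_total 0 (g a) with h | h
    · rw [max_eq_left h, max_eq_right (neg_nonpos.2 h), sub_zero]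
    · rw [max_eq_right h, max_eq_left (neg_nonneg.2 h)]; ring
  · simp only [ENNReal.toReal_ofReal', smul_eq_mul]
    exact hgi.pos_part.mul_bdd (c := 1) hφ.aestronglyMeasurable (.of_forall hφb)
  · simp only [ENNReal.toReal_ofReal', smul_eq_mul]
    exact hgi.neg.pos_part.mul_bdd (c := 1) hφ.aestronglyMeasurable (.of_forall hφb)

theorem withDensity_neg_apply_le {α : Type*} [MeasurableSpace α] {ν : Measure α} {g : α → ℝ}
    {s : Set α} (hs : MeasurableSet s)
    (hgi : Integrable g ν) (h : 0 ≤ ∫ a in s, g a ∂ν) :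
    (ν.withDensity fun a => ENNReal.ofReal (-g a)) s
      ≤ (ν.withDensity fun a => ENNReal.ofReal (g a)) s := by
  rw [withDensity_apply _ hs, withDensity_apply _ hs]
  have hi : Integrable g (ν.restrict s) := hgi.restrict
  rw [integral_eq_lintegral_pos_part_sub_lintegral_neg_part hi, sub_nonneg] at h
  exact (ENNReal.toReal_le_toReal hi.neg.lintegral_lt_top.ne hi.lintegral_lt_top.ne).1 h

/-! ### Rearrangement into a fair pair -/

/-- Two integrable functions on the line with `f₁` monotone, whose partial integrals are ordered and
whose total integrals agree, can be rearranged into a fair pair. -/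
theorem exists_fair_rearrangement (ν : Measure ℝ) [IsFiniteMeasure ν] {f₁ f₂ : ℝ → ℝ} {s : Set ℝ}
    (hs : ∀ᵐ w ∂ν, w ∈ s) (hmono : MonotoneOn f₁ s) (hm₁ : Measurable f₁) (hm₂ : Measurable f₂)
    (hi₁ : Integrable f₁ ν) (hi₂ : Integrable f₂ ν) (heq : ∫ w, f₁ w ∂ν = ∫ w, f₂ w ∂ν)
    (hle : ∀ x, ∫ w in Iic x, f₂ w ∂ν ≤ ∫ w in Iic x, f₁ w ∂ν) :
    ∃ π : Measure (ℝ × ℝ), π.fst = ν.map f₁ ∧ π.snd = ν.map f₂ ∧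
      ∀ φ : ℝ → ℝ, Measurable φ → (∀ x, ‖φ x‖ ≤ 1) → ∫ z, φ z.1 * (z.2 - z.1) ∂π = 0 := by
  set g : ℝ → ℝ := fun w => f₁ w - f₂ w with hg
  have hgm : Measurable g := hm₁.sub hm₂
  have hgi : Integrable g ν := hi₁.sub hi₂
  have hgi' : ∫ w, g w ∂ν = 0 := by rw [integral_sub hi₁ hi₂, heq, sub_self]
  set νp := ν.withDensity fun a => ENNReal.ofReal (g a) with hνp
  set νn := ν.withDensity fun a => ENNReal.ofReal (-g a) with hνn
  have : IsFiniteMeasure νp := isFiniteMeasure_withDensity_ofReal hgi.2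
  have : IsFiniteMeasure νn := isFiniteMeasure_withDensity_ofReal hgi.neg.2
  have huniv : νp univ = νn univ := by
    refine le_antisymm ?_ (withDensity_neg_apply_le .univ hgi (by simp [hgi']))
    have := withDensity_neg_apply_le .univ hgi.neg (by simp [integral_neg, hgi'])
    simpa only [Pi.neg_apply, neg_neg] using this
  obtain ⟨Q, hQ1, hQ2, hQ⟩ := exists_ordered_coupling νp νn huniv fun x => by
    refine withDensity_neg_apply_le measurableSet_Iic hgi ?_
    rw [integral_sub hi₁.integrableOn hi₂.integrableOn]
    exact sub_nonneg.2 (hle x)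
  have hQs1 : ∀ᵐ z ∂Q, z.1 ∈ s ∧ 0 < g z.1 := by
    refine ae_of_ae_map (p := fun w => w ∈ s ∧ 0 < g w) measurable_fst.aemeasurable ?_
    change ∀ᵐ w ∂Q.fst, _
    rw [hQ1]
    exact (show ∀ᵐ w ∂_, w ∈ s from (withDensity_absolutelyContinuous _ _).ae_le hs).and (ae_pos_withDensity_ofReal ν hgm)
  have hQs2 : ∀ᵐ z ∂Q, z.2 ∈ s ∧ 0 < -g z.2 := by
    refine ae_of_ae_map (p := fun w => w ∈ s ∧ 0 < -g w) measurable_snd.aemeasurable ?_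
    change ∀ᵐ w ∂Q.snd, _
    rw [hQ2]
    exact (show ∀ᵐ w ∂_, w ∈ s from (withDensity_absolutelyContinuous _ _).ae_le hs).and
      (ae_pos_withDensity_ofReal ν hgm.neg)
  -- The gain per unit of exchanged mass. It dominates both g(a) and -g(b), so the exchanged mass
  -- `q` = Q/D fits under `ν` at both ends.
  set D : ℝ × ℝ → ℝ := fun z => f₂ z.2 - f₂ z.1 with hD
  have hDm : Measurable D := (hm₂.comp measurable_snd).sub (hm₂.comp measurable_fst)
  have hQle : ∀ᵐ z ∂Q, f₁ z.1 ≤ f₁ z.2 := by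
    filter_upwards [hQ, hQs1, hQs2] with z h h1 h2 using hmono h1.1 h2.1 h
  have hD1 : ∀ᵐ z ∂Q, g z.1 ≤ D z := by
    filter_upwards [hQle, hQs1, hQs2] with z h h1 h2
    simp only [hg, hD] at *; linarith
  have hD2 : ∀ᵐ z ∂Q, -g z.2 ≤ D z := by
    filter_upwards [hQle, hQs1, hQs2] with z h h1 h2
    simp only [hg, hD] at *; linarith
  have hDpos : ∀ᵐ z ∂Q, 0 < D z := by
    filter_upwards [hD1, hQs1] with z h h1 using h1.2.trans_le h
  set q := Q.withDensity fun z => ENNReal.ofReal (D z)⁻¹ with hq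
  have hq1 : q.fst ≤ ν.restrict {a | 0 < g a} :=
    map_withDensity_inv_le hgm measurable_fst hQ1 hD1
  have hq2 : q.snd ≤ ν.restrict {a | 0 < -g a} :=
    map_withDensity_inv_le hgm.neg measurable_snd hQ2 hD2
  have hqν : q.fst + q.snd ≤ ν := by
    have hn : MeasurableSet {a | 0 < -g a} := measurableSet_lt measurable_const hgm.neg
    refine (add_le_add hq1 hq2).trans ?_
    rw [← Measure.restrict_union _ hn]
    · exact Measure.restrict_le_self
    · refine Set.disjoint_left.2 fun a ha ha' => ?_
      simp only [mem_ofPred_eq] at ha ha'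
      linarith
  have hqfin1 : IsFiniteMeasure q.fst :=
    isFiniteMeasure_of_le _ (hq1.trans Measure.restrict_le_self)
  have hqfin2 : IsFiniteMeasure q.snd :=
    isFiniteMeasure_of_le _ (hq2.trans Measure.restrict_le_self)
  -- The mass left unexchanged.
  set r := ν - (q.fst + q.snd) with hr
  have hsum : r + (q.fst + q.snd) = ν := Measure.sub_add_cancel_of_le hqν
  have hm_r : Measurable fun w => (f₁ w, f₂ w) := hm₁.prodMk hm₂
  have hm_a : Measurable fun z : ℝ × ℝ => (f₁ z.1, f₂ z.2) :=
    (hm₁.comp measurable_fst).prodMk (hm₂.comp measurable_snd)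
  have hm_b : Measurable fun z : ℝ × ℝ => (f₁ z.2, f₂ z.1) :=
    (hm₁.comp measurable_snd).prodMk (hm₂.comp measurable_fst)
  have hrν : r ≤ ν := Measure.sub_le
  have int_fst : ∀ {f : ℝ → ℝ}, Integrable f ν → Integrable (fun z : ℝ × ℝ => f z.1) q :=
    fun hf => (hf.mono_measure (hq1.trans Measure.restrict_le_self)).comp_measurable measurable_fst
  have int_snd : ∀ {f : ℝ → ℝ}, Integrable f ν → Integrable (fun z : ℝ × ℝ => f z.2) q :=
    fun hf => (hf.mono_measure (hq2.trans Measure.restrict_le_self)).comp_measurable measurable_snd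
  -- On `r` the pair (f₁, f₂) is kept; on `q` the second coordinates of the two ends are swapped.
  refine ⟨r.map (fun w => (f₁ w, f₂ w)) + (q.map (fun z => (f₁ z.1, f₂ z.2))
    + q.map (fun z => (f₁ z.2, f₂ z.1))), ?_, ?_, fun φ hφ hφb => ?_⟩
  · rw [Measure.fst_add, Measure.fst_add, Measure.fst_map_prodMk hm₂,
      Measure.fst_map_prodMk (Y := fun z : ℝ × ℝ => f₂ z.2) (hm₂.comp measurable_snd),
      Measure.fst_map_prodMk (Y := fun z : ℝ × ℝ => f₂ z.1) (hm₂.comp measurable_fst)]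
    conv_rhs => rw [← hsum, Measure.map_add _ _ hm₁, Measure.map_add _ _ hm₁, Measure.fst,
      Measure.snd, Measure.map_map hm₁ measurable_fst, Measure.map_map hm₁ measurable_snd]
    rfl
  · rw [Measure.snd_add, Measure.snd_add, Measure.snd_map_prodMk hm₁,
      Measure.snd_map_prodMk (X := fun z : ℝ × ℝ => f₁ z.1) (hm₁.comp measurable_fst),
      Measure.snd_map_prodMk (X := fun z : ℝ × ℝ => f₁ z.2) (hm₁.comp measurable_snd)]
    conv_rhs => rw [← hsum, Measure.map_add _ _ hm₂, Measure.map_add _ _ hm₂, Measure.fst,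
      Measure.snd, Measure.map_map hm₂ measurable_fst, Measure.map_map hm₂ measurable_snd]
    rw [add_comm (Measure.map (fun z : ℝ × ℝ => f₂ z.2) q)]
    rfl
  · have hF : Measurable fun z : ℝ × ℝ => φ z.1 * (z.2 - z.1) :=
      (hφ.comp measurable_fst).mul (measurable_snd.sub measurable_fst)
    have bdd : ∀ {α : Type} [MeasurableSpace α] {m : Measure α} {ψ f : α → ℝ}, Measurable ψ →
        (∀ a, ‖ψ a‖ ≤ 1) → Integrable f m → Integrable (fun a => ψ a * f a) m :=
      fun hψ hψb hf => hf.bdd_mul hψ.aestronglyMeasurable (.of_forall hψb)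
    have hφ1 : Measurable fun w => φ (f₁ w) := hφ.comp hm₁
    have hφb1 : ∀ w, ‖φ (f₁ w)‖ ≤ 1 := fun w => hφb _
    have hφf : Measurable fun z : ℝ × ℝ => φ (f₁ z.1) := hφ1.comp measurable_fst
    have hφs : Measurable fun z : ℝ × ℝ => φ (f₁ z.2) := hφ1.comp measurable_snd
    have ir : Integrable (fun w => φ (f₁ w) * (f₂ w - f₁ w)) r :=
      bdd hφ1 hφb1 ((hi₂.sub hi₁).mono_measure hrν)
    have ia : Integrable (fun z : ℝ × ℝ => φ (f₁ z.1) * (f₂ z.2 - f₁ z.1)) q :=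
      bdd hφf (fun z => hφb _) ((int_snd hi₂).sub (int_fst hi₁))
    have ib : Integrable (fun z : ℝ × ℝ => φ (f₁ z.2) * (f₂ z.1 - f₁ z.2)) q :=
      bdd hφs (fun z => hφb _) ((int_fst hi₂).sub (int_snd hi₁))
    have ia' : Integrable (fun z : ℝ × ℝ => φ (f₁ z.1) * (f₂ z.1 - f₁ z.1)) q :=
      bdd hφf (fun z => hφb _) ((int_fst hi₂).sub (int_fst hi₁))
    have ib' : Integrable (fun z : ℝ × ℝ => φ (f₁ z.2) * (f₂ z.2 - f₁ z.2)) q :=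
      bdd hφs (fun z => hφb _) ((int_snd hi₂).sub (int_snd hi₁))
    have e0 : ∫ z, φ z.1 * (z.2 - z.1) ∂(r.map (fun w => (f₁ w, f₂ w))
        + (q.map (fun z => (f₁ z.1, f₂ z.2)) + q.map (fun z => (f₁ z.2, f₂ z.1))))
        = ∫ w, φ (f₁ w) * (f₂ w - f₁ w) ∂r
          + (∫ z, φ (f₁ z.1) * (f₂ z.2 - f₁ z.1) ∂q
            + ∫ z, φ (f₁ z.2) * (f₂ z.1 - f₁ z.2) ∂q) := by
      have jr := (integrable_map_measure hF.aestronglyMeasurable hm_r.aemeasurable).2 ir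
      have ja := (integrable_map_measure hF.aestronglyMeasurable hm_a.aemeasurable).2 ia
      have jb := (integrable_map_measure hF.aestronglyMeasurable hm_b.aemeasurable).2 ib
      rw [integral_add_measure jr (ja.add_measure jb), integral_add_measure ja jb,
        integral_map hm_r.aemeasurable hF.aestronglyMeasurable,
        integral_map hm_a.aemeasurable hF.aestronglyMeasurable,
        integral_map hm_b.aemeasurable hF.aestronglyMeasurable]
    have e1 : ∫ w, φ (f₁ w) * (f₂ w - f₁ w) ∂ν
        = ∫ w, φ (f₁ w) * (f₂ w - f₁ w) ∂r
          + (∫ z, φ (f₁ z.1) * (f₂ z.1 - f₁ z.1) ∂q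
            + ∫ z, φ (f₁ z.2) * (f₂ z.2 - f₁ z.2) ∂q) := by
      have hK : Measurable fun w => φ (f₁ w) * (f₂ w - f₁ w) := hφ1.mul (hm₂.sub hm₁)
      have jν : Integrable (fun w => φ (f₁ w) * (f₂ w - f₁ w)) ν :=
        bdd hφ1 hφb1 (hi₂.sub hi₁)
      have jf := jν.mono_measure (hq1.trans Measure.restrict_le_self)
      have js := jν.mono_measure (hq2.trans Measure.restrict_le_self)
      conv_lhs => rw [← hsum]
      rw [integral_add_measure ir (jf.add_measure js), integral_add_measure jf js,
        Measure.fst, Measure.snd, integral_map measurable_fst.aemeasurable hK.aestronglyMeasurable,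
        integral_map measurable_snd.aemeasurable hK.aestronglyMeasurable]
    -- The swap changes the integrand by φ(f₁(a)) D, and D q = Q has first marginal `νp`; `eb` is
    -- the same at the other end.
    have ea : ∫ z, φ (f₁ z.1) * (f₂ z.2 - f₁ z.1) ∂q - ∫ z, φ (f₁ z.1) * (f₂ z.1 - f₁ z.1) ∂q
        = ∫ w, φ (f₁ w) ∂νp := by
      rw [← integral_sub ia ia', ← hQ1, Measure.fst,
        integral_map measurable_fst.aemeasurable hφ1.aestronglyMeasurable,
        ← integral_withDensity_inv_mul hDm hDpos]
      refine integral_congr_ae (.of_forall fun z => ?_)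
      simp only [hD]; ring
    have eb : ∫ z, φ (f₁ z.2) * (f₂ z.2 - f₁ z.2) ∂q - ∫ z, φ (f₁ z.2) * (f₂ z.1 - f₁ z.2) ∂q
        = ∫ w, φ (f₁ w) ∂νn := by
      rw [← integral_sub ib' ib, ← hQ2, Measure.snd,
        integral_map measurable_snd.aemeasurable hφ1.aestronglyMeasurable,
        ← integral_withDensity_inv_mul hDm hDpos]
      refine integral_congr_ae (.of_forall fun z => ?_)
      simp only [hD]; ring
    have eg : ∫ w, φ (f₁ w) * (f₂ w - f₁ w) ∂ν = -∫ w, φ (f₁ w) * g w ∂ν := by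
      rw [← integral_neg]
      refine integral_congr_ae (.of_forall fun w => ?_)
      simp only [hg]; ring
    have ed := integral_withDensity_ofReal_sub hgm hgi hφ1 hφb1
    rw [e0]
    linarith

/-! ### Fair couplings and Lorenz values -/

/-- Random variables `X`, `U` on any probability space give a value in the minimization defining the
Lorenz curve of the law of `X`. -/
theorem setIntegral_mem_lorenzValues {Ω : Type*} [MeasurableSpace Ω] {P : Measure Ω}
    [IsProbabilityMeasure P] {X U : Ω → ℝ} (hX : Measurable X) (hU : Measurable U) {A : Set ℝ}
    (hA : MeasurableSet A) :
    ∫ ω in U ⁻¹' A, X ω ∂P ∈ lorenzValues (P.map X) (P.real (U ⁻¹' A)) := by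
  have hXU := hX.prodMk hU
  have hA' : MeasurableSet ((Prod.snd : ℝ × ℝ → ℝ) ⁻¹' A) := measurable_snd hA
  refine ⟨condDistrib U X P, A, inferInstance, hA, ?_, ?_⟩
  · rw [compProd_map_condDistrib hU.aemeasurable, map_measureReal_apply hXU hA']
    rfl
  · rw [compProd_map_condDistrib hU.aemeasurable,
      setIntegral_map hA' measurable_fst.aestronglyMeasurable hXU.aemeasurable]
    rfl

theorem compProd_real_snd_preimage (μ : Measure ℝ) [IsProbabilityMeasure μ] (κ : Kernel ℝ ℝ)
    [IsMarkovKernel κ] {A : Set ℝ} (hA : MeasurableSet A) :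
    (μ ⊗ₘ κ).real (Prod.snd ⁻¹' A) = ∫ x, (κ x).real A ∂μ := by
  have := integral_indicator_const (μ := μ ⊗ₘ κ) (1 : ℝ) (measurable_snd hA)
  rw [smul_eq_mul, mul_one] at this
  rw [← this, Measure.integral_compProd
    ((integrable_const (1 : ℝ)).indicator (measurable_snd hA))]
  refine integral_congr_ae (.of_forall fun x => ?_)
  have := integral_indicator_const (μ := κ x) (1 : ℝ) hA
  rw [smul_eq_mul, mul_one] at this
  exact this

theorem setIntegral_compProd_snd_preimage {μ : Measure ℝ} [IsProbabilityMeasure μ]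
    (hμ : Integrable (fun x : ℝ => x) μ) (κ : Kernel ℝ ℝ) [IsMarkovKernel κ] {A : Set ℝ}
    (hA : MeasurableSet A) :
    ∫ z in Prod.snd ⁻¹' A, z.1 ∂(μ ⊗ₘ κ) = ∫ x, x * (κ x).real A ∂μ := by
  have hint : Integrable (fun z : ℝ × ℝ => z.1) (μ ⊗ₘ κ) := by
    rw [← Measure.fst_compProd μ κ] at hμ
    exact hμ.comp_measurable measurable_fst
  have hset : (Prod.snd ⁻¹' A : Set (ℝ × ℝ)) = univ ×ˢ A := by ext; simp
  rw [hset, Measure.setIntegral_compProd .univ hA hint.integrableOn, Measure.restrict_univ]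
  refine integral_congr_ae (.of_forall fun x => ?_)
  simp [mul_comm]

/-- The event built for `X₁` is reused for `X₂`: fairness leaves its probability and the expectation
on it unchanged. -/
theorem lorenzValues_subset_of_isFairCoupling {μ₁ μ₂ : Measure ℝ} [IsProbabilityMeasure μ₁]
    [IsProbabilityMeasure μ₂] (h₁ : Integrable (fun x : ℝ => x) μ₁)
    (h₂ : Integrable (fun x : ℝ => x) μ₂) {π : Measure (ℝ × ℝ)} (hπ : IsFairCoupling μ₁ μ₂ π)
    (u : ℝ) : lorenzValues μ₁ u ⊆ lorenzValues μ₂ u := by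
  rintro v ⟨κ, A, hκ, hA, rfl, rfl⟩
  have hprob : IsProbabilityMeasure π :=
    ⟨by rw [← Measure.fst_univ, hπ.fst_eq, measure_univ]⟩
  have hi : Integrable (fun z : ℝ × ℝ => z.2) π := by
    rw [← hπ.snd_eq] at h₂
    exact h₂.comp_measurable measurable_snd
  have hm : Measurable (fun x => (κ x).real A) := (κ.measurable_coe hA).ennreal_toReal
  -- The kernel sees only the first coordinate: `U` is conditionally independent of `X₂` given `X₁`.
  set P : Measure ((ℝ × ℝ) × ℝ) := π ⊗ₘ (κ.comap Prod.fst measurable_fst) with hP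
  have key := setIntegral_mem_lorenzValues (P := P) (X := fun ω => ω.1.2) (U := Prod.snd)
    (measurable_snd.comp measurable_fst) measurable_snd hA
  have hmap : P.map (fun ω => ω.1.2) = μ₂ := by
    have : P.map (fun ω => ω.1.2) = (P.map Prod.fst).map Prod.snd :=
      (Measure.map_map measurable_snd measurable_fst).symm
    rw [this, ← Measure.fst, hP, Measure.fst_compProd, ← Measure.snd, hπ.snd_eq]
  have hset : (Prod.snd ⁻¹' A : Set ((ℝ × ℝ) × ℝ)) = univ ×ˢ A := by ext; simp
  have hPA : P.real (Prod.snd ⁻¹' A) = (μ₁ ⊗ₘ κ).real (Prod.snd ⁻¹' A) := by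
    rw [measureReal_def, measureReal_def, hP, hset, Measure.compProd_apply_prod .univ hA,
      show (Prod.snd ⁻¹' A : Set (ℝ × ℝ)) = univ ×ˢ A by ext; simp,
      Measure.compProd_apply_prod .univ hA, Measure.restrict_univ, Measure.restrict_univ,
      ← hπ.fst_eq, Measure.fst, lintegral_map (κ.measurable_coe hA) measurable_fst]
    rfl
  have hint : ∫ ω in Prod.snd ⁻¹' A, ω.1.2 ∂P = ∫ z in Prod.snd ⁻¹' A, z.1 ∂(μ₁ ⊗ₘ κ) := by
    have hi' : Integrable (fun ω : (ℝ × ℝ) × ℝ => ω.1.2) P := by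
      rw [← Measure.fst_compProd π (κ.comap Prod.fst measurable_fst)] at hi
      exact hi.comp_measurable measurable_fst
    rw [setIntegral_compProd_snd_preimage h₁ κ hA, hset, hP,
      Measure.setIntegral_compProd .univ hA hi'.integrableOn, Measure.restrict_univ,
      ← hπ.fst_eq, Measure.fst, integral_map measurable_fst.aemeasurable
        (f := fun x => x * (κ x).real A) (measurable_id.mul hm).aestronglyMeasurable]
    have hle : MeasurableSpace.comap (Prod.fst : ℝ × ℝ → ℝ) inferInstance
        ≤ (inferInstance : MeasurableSpace (ℝ × ℝ)) := measurable_fst.comap_le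
    have hsm : StronglyMeasurable[MeasurableSpace.comap (Prod.fst : ℝ × ℝ → ℝ) inferInstance]
        (fun z : ℝ × ℝ => (κ z.1).real A) :=
      (hm.comp (comap_measurable Prod.fst)).stronglyMeasurable
    have hpi : Integrable (fun z : ℝ × ℝ => (κ z.1).real A * z.2) π :=
      hi.bdd_mul (c := 1) (hm.comp measurable_fst).aestronglyMeasurable
        (.of_forall fun z => by
          rw [Real.norm_of_nonneg measureReal_nonneg]; exact measureReal_le_one)
    have hpull := condExp_mul_of_stronglyMeasurable_left hsm hpi hi
    calc ∫ z : ℝ × ℝ, ∫ y in A, (z, y).1.2 ∂(κ.comap Prod.fst measurable_fst z) ∂π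
        = ∫ z : ℝ × ℝ, (κ z.1).real A * z.2 ∂π := by simp
      _ = ∫ z, (π[(fun z : ℝ × ℝ => (κ z.1).real A * z.2) |
            MeasurableSpace.comap Prod.fst inferInstance]) z ∂π := (integral_condExp hle).symm
      _ = ∫ z : ℝ × ℝ, z.1 * (κ z.1).real A ∂π := by
        refine integral_congr_ae ?_
        filter_upwards [hpull, hπ.condExp_eq] with z hz hz'
        refine hz.trans ?_
        rw [Pi.mul_apply, mul_comm]
        exact congrArg (· * (κ z.1).real A) hz'
  rwa [hmap, hPA, hint] at key

/-! ### Lorenz curves as partial integrals of quantiles -/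

theorem integrable_quantile {μ : Measure ℝ} [IsProbabilityMeasure μ]
    (hμ : Integrable (fun x : ℝ => x) μ) : Integrable (quantile μ) unitUniform := by
  rw [← map_quantile μ] at hμ
  exact hμ.comp_measurable (measurable_quantile μ)

theorem integral_quantile (μ : Measure ℝ) [IsProbabilityMeasure μ] :
    ∫ w, quantile μ w ∂unitUniform = ∫ x, x ∂μ := by
  conv_rhs => rw [← map_quantile μ]
  exact (integral_map (measurable_quantile μ).aemeasurable
    measurable_id.aestronglyMeasurable).symm

theorem setIntegral_quantile_mem_lorenzValues (μ : Measure ℝ) [IsProbabilityMeasure μ] {u : ℝ}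
    (hu : u ∈ Icc (0 : ℝ) 1) :
    ∫ w in Iic u, quantile μ w ∂unitUniform ∈ lorenzValues μ u := by
  have := setIntegral_mem_lorenzValues (P := unitUniform) (measurable_quantile μ) measurable_id
    (measurableSet_Iic (a := u))
  rwa [map_quantile, preimage_id, unitUniform_real_Iic hu.1 hu.2] at this

/-- Bathtub principle: among weights f in [0,1] with integral u, the one filling the lowest
quantiles first, 1_{w ≤ u}, minimizes ∫ G f. -/
theorem setIntegral_quantile_le_of_mem_lorenzValues {μ : Measure ℝ} [IsProbabilityMeasure μ]
    (hμ : Integrable (fun x : ℝ => x) μ) {u v : ℝ} (hu : u ∈ Ioo (0 : ℝ) 1)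
    (hv : v ∈ lorenzValues μ u) : ∫ w in Iic u, quantile μ w ∂unitUniform ≤ v := by
  obtain ⟨κ, A, hκ, hA, hu', rfl⟩ := hv
  rw [compProd_real_snd_preimage μ κ hA] at hu'
  rw [setIntegral_compProd_snd_preimage hμ κ hA]
  have hm : Measurable fun x => (κ x).real A := (κ.measurable_coe hA).ennreal_toReal
  have hG := measurable_quantile μ
  have hGi := integrable_quantile hμ
  set G := quantile μ with hGdef
  set f : ℝ → ℝ := fun w => (κ (G w)).real A with hf
  have hfm : Measurable f := hm.comp hG
  have hfb : ∀ w, ‖f w‖ ≤ 1 := fun w => by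
    rw [Real.norm_of_nonneg measureReal_nonneg]; exact measureReal_le_one
  have hfi : Integrable f unitUniform :=
    Integrable.of_bound hfm.aestronglyMeasurable 1 (.of_forall hfb)
  have hfu : ∫ w, f w ∂unitUniform = u := by
    rw [← hu']
    conv_rhs => rw [← map_quantile μ]
    exact (integral_map hG.aemeasurable hm.aestronglyMeasurable).symm
  have hGf : ∫ w, G w * f w ∂unitUniform = ∫ x, x * (κ x).real A ∂μ := by
    conv_rhs => rw [← map_quantile μ]
    exact (integral_map (f := fun x => x * (κ x).real A) hG.aemeasurable
      (measurable_id.mul hm).aestronglyMeasurable).symm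
  set i : ℝ → ℝ := (Iic u).indicator 1 with hi
  have hii : Integrable i unitUniform := (integrable_const (1 : ℝ)).indicator measurableSet_Iic
  have hiu : ∫ w, i w ∂unitUniform = u := by
    rw [hi, integral_indicator_one measurableSet_Iic, unitUniform_real_Iic hu.1.le hu.2.le]
  have hGi_eq : ∫ w, (Iic u).indicator G w ∂unitUniform = ∫ w in Iic u, G w ∂unitUniform :=
    integral_indicator measurableSet_Iic
  have hGfi : Integrable (fun w => G w * f w) unitUniform :=
    hGi.mul_bdd (c := 1) hfm.aestronglyMeasurable (.of_forall hfb)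
  -- The integrand is (G w - G u)(f w - i w), whose factors never have opposite signs. The G u term
  -- integrates to zero.
  have hnonneg : 0 ≤ ∫ w, ((G w * f w - (Iic u).indicator G w) - G u * (f w - i w))
      ∂unitUniform := by
    refine integral_nonneg_of_ae ?_
    filter_upwards [ae_restrict_mem measurableSet_Ioo] with w hw
    have h0 : 0 ≤ f w := measureReal_nonneg
    have h1 : f w ≤ 1 := (le_abs_self _).trans (hfb w)
    rcases le_or_gt w u with h | h
    · have hle : G w ≤ G u := monotoneOn_quantile μ hw hu h
      simp only [hi, indicator_of_mem (show w ∈ Iic u from h), Pi.one_apply, Pi.zero_apply]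
      nlinarith
    · have hle : G u ≤ G w := monotoneOn_quantile μ hu hw h.le
      simp only [hi, indicator_of_notMem (show w ∉ Iic u from not_le.2 h), Pi.zero_apply]
      nlinarith
  have hd₁ : Integrable (fun w => G w * f w - (Iic u).indicator G w) unitUniform :=
    hGfi.sub (hGi.indicator measurableSet_Iic)
  have hd₂ : Integrable (fun w => G u * (f w - i w)) unitUniform := (hfi.sub hii).const_mul _
  rw [integral_sub hd₁ hd₂,
    integral_sub hGfi (hGi.indicator measurableSet_Iic), integral_const_mul,
    integral_sub hfi hii, hfu, hiu, sub_self, mul_zero, sub_zero, hGf, hGi_eq] at hnonneg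
  linarith

/-- Inside (0,1) the bathtub bound is needed for `μ₂` only; for `μ₁` it suffices that the quantile
integral is a competitor. Beyond 1 the equal means decide. -/
theorem setIntegral_quantile_le_of_lorenz_le {μ₁ μ₂ : Measure ℝ} [IsProbabilityMeasure μ₁]
    [IsProbabilityMeasure μ₂] (h₁_nonneg : ∀ᵐ x ∂μ₁, 0 ≤ x)
    (h₂_int : Integrable (fun x : ℝ => x) μ₂)
    (hmean : ∫ x, x ∂μ₁ = ∫ x, x ∂μ₂)
    (h : ∀ u ∈ Icc (0 : ℝ) 1, lorenz μ₂ u ≤ lorenz μ₁ u) (x : ℝ) :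
    ∫ w in Iic x, quantile μ₂ w ∂unitUniform ≤ ∫ w in Iic x, quantile μ₁ w ∂unitUniform := by
  rcases le_or_gt x 0 with h0 | h0
  · have : unitUniform.restrict (Iic x) = 0 := by
      rw [Measure.restrict_eq_zero, Measure.restrict_apply measurableSet_Iic]
      convert measure_empty (μ := volume)
      ext w; simp only [mem_inter_iff, mem_Iic, mem_Ioo, mem_empty_iff_false]; grind
    simp [this]
  rcases lt_or_ge x 1 with h1 | h1
  · calc ∫ w in Iic x, quantile μ₂ w ∂unitUniform
        ≤ lorenz μ₂ x := le_csInf (lorenzValues_nonempty μ₂ ⟨h0.le, h1.le⟩) fun v hv =>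
          setIntegral_quantile_le_of_mem_lorenzValues h₂_int ⟨h0, h1⟩ hv
      _ ≤ lorenz μ₁ x := h x ⟨h0.le, h1.le⟩
      _ ≤ _ := csInf_le (lorenzValues_bddBelow μ₁ h₁_nonneg x)
          (setIntegral_quantile_mem_lorenzValues μ₁ ⟨h0.le, h1.le⟩)
  · have : unitUniform.restrict (Iic x) = unitUniform := by
      rw [Measure.restrict_eq_self_of_ae_mem]
      filter_upwards [ae_restrict_mem measurableSet_Ioo] with w hw using hw.2.le.trans h1
    rw [this, integral_quantile, integral_quantile, hmean]

/-! ### Fairness by test functions, and the equivalence -/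

/-- A coupling that is fair when tested against bounded functions of the first coordinate is a fair
coupling. -/
theorem isFairCoupling_of_integral_eq_zero {μ₁ μ₂ : Measure ℝ} [IsProbabilityMeasure μ₁]
    (h₁ : Integrable (fun x : ℝ => x) μ₁) (h₂ : Integrable (fun x : ℝ => x) μ₂)
    {π : Measure (ℝ × ℝ)} (hfst : π.fst = μ₁) (hsnd : π.snd = μ₂)
    (h : ∀ φ : ℝ → ℝ, Measurable φ → (∀ x, ‖φ x‖ ≤ 1) → ∫ z, φ z.1 * (z.2 - z.1) ∂π = 0) :
    IsFairCoupling μ₁ μ₂ π := by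
  have hprob : IsProbabilityMeasure π := ⟨by rw [← Measure.fst_univ, hfst, measure_univ]⟩
  have hi₁ : Integrable (fun z : ℝ × ℝ => z.1) π := by
    rw [← hfst] at h₁
    exact h₁.comp_measurable measurable_fst
  have hi₂ : Integrable (fun z : ℝ × ℝ => z.2) π := by
    rw [← hsnd] at h₂
    exact h₂.comp_measurable measurable_snd
  refine ⟨hfst, hsnd, (ae_eq_condExp_of_forall_setIntegral_eq measurable_fst.comap_le hi₂
    (fun _ _ _ => hi₁.integrableOn) ?_
    (comap_measurable Prod.fst).stronglyMeasurable.aestronglyMeasurable).symm⟩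
  -- Events of the σ-algebra of `X₁` are preimages of Borel sets B; the test function is 1_B.
  rintro _ ⟨B, hB, rfl⟩ -
  have hB' : MeasurableSet (Prod.fst ⁻¹' B : Set (ℝ × ℝ)) := measurable_fst hB
  have key := h (B.indicator 1) (measurable_one.indicator hB) fun x => by
    by_cases hx : x ∈ B <;> simp [hx]
  have : (fun z : ℝ × ℝ => B.indicator 1 z.1 * (z.2 - z.1))
      = (Prod.fst ⁻¹' B).indicator fun z => z.2 - z.1 := by
    ext z
    by_cases hz : z.1 ∈ B <;> simp [indicator, hz]
  rw [this, integral_indicator hB', integral_sub hi₂.integrableOn hi₁.integrableOn,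
    sub_eq_zero] at key
  exact key.symm

theorem theorem1 (μ₁ μ₂ : Measure ℝ) [IsProbabilityMeasure μ₁] [IsProbabilityMeasure μ₂]
    (h₁_nonneg : ∀ᵐ x ∂μ₁, 0 ≤ x) (h₂_nonneg : ∀ᵐ x ∂μ₂, 0 ≤ x)
    (h₁_int : Integrable (fun x : ℝ => x) μ₁) (h₂_int : Integrable (fun x : ℝ => x) μ₂)
    (h₁_mean : ∫ x, x ∂μ₁ = 1) (h₂_mean : ∫ x, x ∂μ₂ = 1) :
    (∃ π : Measure (ℝ × ℝ), IsFairCoupling μ₁ μ₂ π) ↔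
      ∀ u ∈ Set.Icc (0 : ℝ) 1, lorenz μ₁ u ≥ lorenz μ₂ u := by
  have hmean : ∫ x, x ∂μ₁ = ∫ x, x ∂μ₂ := h₁_mean.trans h₂_mean.symm
  constructor
  · rintro ⟨π, hπ⟩ u hu
    exact csInf_le_csInf (lorenzValues_bddBelow μ₂ h₂_nonneg u) (lorenzValues_nonempty μ₁ hu)
      (lorenzValues_subset_of_isFairCoupling h₁_int h₂_int hπ u)
  · intro h
    obtain ⟨π, hfst, hsnd, hπ⟩ := exists_fair_rearrangement unitUniform
      (ae_restrict_mem measurableSet_Ioo) (monotoneOn_quantile μ₁) (measurable_quantile μ₁)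
      (measurable_quantile μ₂) (integrable_quantile h₁_int) (integrable_quantile h₂_int)
      (by rw [integral_quantile, integral_quantile, hmean])
      (setIntegral_quantile_le_of_lorenz_le h₁_nonneg h₂_int hmean h)
    rw [map_quantile] at hfst hsnd
    exact ⟨π, isFairCoupling_of_integral_eq_zero h₁_int h₂_int hfst hsnd hπ⟩
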